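/- Let $F(z,w,w')$ be a polynomial in $w,w'$ with coefficients in $\mathbb{C}(z)$ that is irreducible in $\mathbb{C}(z)[w,w']$. Suppose that the differential equation $F(z,w,w')=0$ has a rational general solution, that is, there is a rational function $r(z,\lambda)\in\mathbb{C}(z,\lambda)$ which really depends on the arbitrary constant $\lambda$ (i.e. $r\notin\mathbb{C}(z)$) and satisfies $F\bigl(z,r,\tfrac{\partial r}{\partial z}\bigr)=0$ identically in $\mathbb{C}(z,\lambda)$. Then for all but finitely many $z_0\in\mathbb{C}$ the polynomial $F(z_0,x,y)\in\mathbb{C}[x,y]$ is irreducible and the plane curve $F(z_0,x,y)=0$ has genus zero, where the genus of an irreducible plane curve $f(x,y)=0$ over $\mathbb{C}$ is the dimension over $\mathbb{C}$ of the space of everywhere regular differentials of its function field $\operatorname{Frac}(\mathbb{C}[x,y]/(f))$. -/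

import Mathlib

open scoped KaehlerDifferential

noncomputable section

/-- The derivative `d/dz` of a rational function `f = p / q` in `z`, by the quotient rule applied
to the reduced fraction. -/
def ratDeriv (f : RatFunc ℂ) : RatFunc ℂ :=
  (algebraMap (Polynomial ℂ) (RatFunc ℂ))
      (Polynomial.derivative f.num * f.denom - f.num * Polynomial.derivative f.denom) /
    (algebraMap (Polynomial ℂ) (RatFunc ℂ)) (f.denom ^ 2)

/-- The derivative `∂/∂z` of a polynomial in `lam` with coefficients in `ℂ(z)`:
every coefficient is differentiated. -/
def polyPartialZ (p : Polynomial (RatFunc ℂ)) : Polynomial (RatFunc ℂ) :=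
  p.sum fun n a => Polynomial.monomial n (ratDeriv a)

/-- The field `ℂ(z, lam)`, written as `ℂ(z)(lam)`: the inner variable is `z`, the outer one is the
arbitrary constant `lam`. -/
abbrev RatFuncZLam : Type := RatFunc (RatFunc ℂ)

/-- The partial derivative `∂r/∂z` of a rational function `r` in `z` and `lam`, by the quotient
rule applied to the reduced fraction. -/
def partialZ (r : RatFuncZLam) : RatFuncZLam :=
  (algebraMap (Polynomial (RatFunc ℂ)) RatFuncZLam)
      (polyPartialZ r.num * r.denom - r.num * polyPartialZ r.denom) /
    (algebraMap (Polynomial (RatFunc ℂ)) RatFuncZLam) (r.denom ^ 2)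

/-- `F` is a polynomial in `w` (variable `0`) and `w'` (variable `1`) over `ℂ(z)`.
A rational function `r` in `z` and `lam` is a rational general solution of `F(z, w, w') = 0` if
`F(z, r, ∂r/∂z) = 0` identically in `z` and `lam`, and `r` really contains the arbitrary constant
`lam`, that is, `r` is not a function of `z` alone. -/
structure IsRationalGeneralSolution (F : MvPolynomial (Fin 2) (RatFunc ℂ)) (r : RatFuncZLam) :
    Prop where
  solves : MvPolynomial.aeval ![r, partialZ r] F = 0
  depends_on_constant : r ∉ Set.range (algebraMap (RatFunc ℂ) RatFuncZLam)

/-- The polynomial `F(z₀, x, y)` in `x` (variable `0`) and `y` (variable `1`): every coefficient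
of `F` is evaluated at `z₀`. (This is meaningful unless `z₀` is one of the finitely many poles of
the coefficients.) -/
def specializeAt (F : MvPolynomial (Fin 2) (RatFunc ℂ)) (z₀ : ℂ) : MvPolynomial (Fin 2) ℂ :=
  ∑ m ∈ F.support, MvPolynomial.monomial m ((F.coeff m).eval (RingHom.id ℂ) z₀)

/-- For a function field `K` over `ℂ`: the differentials that are regular at every place, i.e.
that lie, for every valuation ring `O` of `K` over `ℂ`, in the `O`-module generated by
`{dt | t ∈ O}` (for a function field of one variable this is `O dt`, `t` a uniformizer). -/
def regularDifferentials (K : Type) [Field K] [Algebra ℂ K] : Submodule ℂ (Ω[K⁄ℂ]) where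
  carrier := {ω | ∀ O : ValuationSubring K, (∀ c : ℂ, algebraMap ℂ K c ∈ O) →
    ω ∈ Submodule.span O (KaehlerDifferential.D ℂ K '' (O : Set K))}
  zero_mem' := fun _ _ => Submodule.zero_mem _
  add_mem' := fun ha hb O hO => Submodule.add_mem _ (ha O hO) (hb O hO)
  smul_mem' := fun c ω hω O hO => by
    have h := Submodule.smul_mem _ (⟨algebraMap ℂ K c, hO c⟩ : O) (hω O hO)
    have e : (⟨algebraMap ℂ K c, hO c⟩ : O) • ω = c • ω := algebraMap_smul K c ω
    rwa [e] at h

/-- The genus of a function field `K` over `ℂ`: the dimension of its space of everywhere regular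
differentials (as a cardinal, so that no finiteness is presupposed). -/
def functionFieldGenus (K : Type) [Field K] [Algebra ℂ K] : Cardinal :=
  Module.rank ℂ (regularDifferentials K)

/-- The coordinate ring `ℂ[x, y] / (f)` of the affine plane curve `f = 0`. -/
abbrev CoordRing (f : MvPolynomial (Fin 2) ℂ) : Type :=
  MvPolynomial (Fin 2) ℂ ⧸ Ideal.span {f}

theorem isDomain_coordRing {f : MvPolynomial (Fin 2) ℂ} (hf : Irreducible f) :
    IsDomain (CoordRing f) :=
  (Ideal.Quotient.isDomain_iff_prime _).2 ((Ideal.span_singleton_prime hf.ne_zero).2 hf.prime)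

/-- The (geometric) genus of the irreducible plane curve `f = 0`: the genus of its function field,
the field of fractions of the coordinate ring. -/
def planeCurveGenus (f : MvPolynomial (Fin 2) ℂ) (hf : Irreducible f) : Cardinal :=
  haveI : IsDomain (CoordRing f) := isDomain_coordRing hf
  functionFieldGenus (FractionRing (CoordRing f))

end

/-!
Clear denominators, so that `F` and the parametrization `v = (r, ∂r/∂z)` have coefficients in
`R = ℂ[z]`. Since `r` is transcendental over `ℂ(z)`, the polynomials vanishing at `v` are the
multiples of `F`, by a dimension count. Hence, if the monomial `m₀` occurs in `F`, the monomials
other than `m₀` of degree at most `deg F` take linearly independent values at `v`.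

Linear independence of finitely many polynomials in `lam` spreads out: a coefficient matrix with
independent rows has a right inverse over `ℂ(z)`, and a common denominator `c` of that inverse
only has to be nonzero at `z₀` for the rows to stay independent there. So for almost all `z₀`
every polynomial of degree at most `deg F` vanishing on the specialized parametrization is
proportional to `F(z₀, x, y)`. In any factorization of `F(z₀, x, y)` one factor vanishes there,
hence is divisible by `F(z₀, x, y)`, so `F(z₀, x, y)` is irreducible.
Likewise `r` stays independent of `1`, so the specialized parametrization is not constant and
embeds the function field of the curve in `ℂ(lam)`.

Regular differentials pull back injectively along this embedding. On `ℂ(lam)` there are none but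
`0`: regularity at the finite places makes the coefficient of `d lam` a polynomial, and since
differentiation lowers the order of growth at infinity, regularity there forces this polynomial to
have negative degree.
-/

open scoped TensorProduct Polynomial nonZeroDivisors

section PlaneCurve

theorem krullDimLE_quotient_span_singleton {R : Type*} [CommRing R] {n : ℕ}
    [Ring.KrullDimLE (n + 1) R] {a : R} (ha : a ∈ R⁰) :
    Ring.KrullDimLE n (R ⧸ Ideal.span {a}) := by
  have hR : ringKrullDim R ≤ (n + 1 : ℕ) := Ring.krullDimLE_iff.1 ‹_›
  have h := (ringKrullDim_quotient_succ_le_of_nonZeroDivisor ha).trans hR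
  rw [Nat.cast_add, Nat.cast_one] at h
  exact Ring.krullDimLE_iff.2 (ENat.WithBot.add_le_add_one_right_iff.1 h)

theorem krullDimLE_mvPolynomial_fin (k : Type*) [Field k] (n : ℕ) :
    Ring.KrullDimLE n (MvPolynomial (Fin n) k) := by
  rw [Ring.krullDimLE_iff, MvPolynomial.ringKrullDim_of_isNoetherianRing,
    ringKrullDim_eq_zero_of_field, zero_add, Nat.card_fin]

variable {k L : Type*} [Field k] [CommRing L] [IsDomain L] [Algebra k L]

theorem algHom_injective_of_transcendental {A : Type*} [CommRing A] [IsDomain A] [Algebra k A]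
    [Algebra.FiniteType k A] [Ring.KrullDimLE 1 A] (ψ : A →ₐ[k] L) {a : A}
    (ha : Transcendental k (ψ a)) : Function.Injective ψ := by
  rw [RingHom.injective_iff_ker_eq_bot]
  by_contra hne
  have hmax : (RingHom.ker ψ).IsMaximal := (RingHom.ker_isPrime ψ).isMaximal_of_ne_bot hne
  let _ := Ideal.Quotient.field (RingHom.ker ψ)
  have : Module.Finite k (A ⧸ RingHom.ker ψ) := finite_of_finite_type_of_isJacobsonRing k _
  have hint : IsIntegral k (Ideal.Quotient.mk (RingHom.ker ψ) a) :=
    Algebra.IsIntegral.isIntegral _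
  exact ha (by simpa using (hint.map (Ideal.kerLiftAlg ψ)).isAlgebraic)

theorem ker_algHom_eq_span_of_transcendental {F G : MvPolynomial (Fin 2) k} (hF : Irreducible F)
    (ψ : MvPolynomial (Fin 2) k →ₐ[k] L) (hψ : ψ F = 0) (hG : Transcendental k (ψ G)) :
    RingHom.ker ψ = Ideal.span {F} := by
  have : (Ideal.span {F}).IsPrime := (Ideal.span_singleton_prime hF.ne_zero).2 hF.prime
  have : Ring.KrullDimLE (1 + 1) (MvPolynomial (Fin 2) k) := krullDimLE_mvPolynomial_fin k 2
  have : Ring.KrullDimLE 1 (MvPolynomial (Fin 2) k ⧸ Ideal.span {F}) :=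
    krullDimLE_quotient_span_singleton (mem_nonZeroDivisors_of_ne_zero hF.ne_zero)
  have hle : ∀ a ∈ Ideal.span {F}, ψ a = 0 :=
    (Ideal.span_singleton_le_iff_mem (RingHom.ker ψ)).2 hψ
  exact (Ideal.injective_lift_iff hle).1 <|
    algHom_injective_of_transcendental (Ideal.Quotient.liftₐ (Ideal.span {F}) ψ hle)
      (a := Ideal.Quotient.mk _ G) hG

theorem ker_aeval_eq_span_of_notMem_range {F : MvPolynomial (Fin 2) k} (hF : Irreducible F)
    {w : Fin 2 → RatFunc k} (hw : MvPolynomial.aeval w F = 0) {i : Fin 2}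
    (hwi : w i ∉ Set.range (algebraMap k (RatFunc k))) :
    RingHom.ker (MvPolynomial.aeval w : MvPolynomial (Fin 2) k →ₐ[k] RatFunc k) =
      Ideal.span {F} := by
  refine ker_algHom_eq_span_of_transcendental hF (MvPolynomial.aeval w) hw (G := .X i) ?_
  rw [MvPolynomial.aeval_X]
  exact RatFunc.transcendental_of_ne_C _ fun ⟨c, hc⟩ => hwi ⟨c, by rw [hc]; rfl⟩

end PlaneCurve

section KaehlerDifferential

variable (k K L : Type*) [Field k] [Field K] [PerfectField K] [Field L] [Algebra k K] [Algebra k L]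
  [Algebra K L] [IsScalarTower k K L] [Algebra.EssFiniteType k L]

theorem mapBaseChange_injective_of_perfectField :
    Function.Injective (KaehlerDifferential.mapBaseChange k K L) := by
  have : Algebra.EssFiniteType K L := Algebra.EssFiniteType.of_comp k K L
  rw [injective_iff_map_eq_zero]
  intro x hx
  -- Since `K` is perfect, `L` is formally smooth over `K`, so `H1Cotangent K L` vanishes.
  obtain ⟨y, rfl⟩ := (Algebra.H1Cotangent.exact_δ_mapBaseChange k K L x).1 hx
  rw [Subsingleton.elim y 0, map_zero]

theorem map_kaehlerDifferential_injective_of_perfectField :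
    Function.Injective (KaehlerDifferential.map k k K L) := by
  convert (mapBaseChange_injective_of_perfectField k K L).comp
    (Module.FaithfullyFlat.tensorProduct_mk_injective (A := K) (B := L) (Ω[K⁄k])) using 1
  ext x
  simp only [Function.comp_apply, TensorProduct.mk_apply, KaehlerDifferential.mapBaseChange_tmul,
    one_smul]

end KaehlerDifferential

section RegularDifferentials

variable {K L : Type} [Field K] [Algebra ℂ K] [Field L] [Algebra ℂ L]

theorem map_mem_of_mem_regularDifferentials {ω : Ω[K⁄ℂ]} (hω : ω ∈ regularDifferentials K)
    {M : Type*} [AddCommGroup M] [Module K M] (e : Ω[K⁄ℂ] →ₗ[K] M) {O : ValuationSubring K}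
    (hO : ∀ c : ℂ, algebraMap ℂ K c ∈ O) (N : Submodule O M)
    (hN : ∀ t ∈ O, e (KaehlerDifferential.D ℂ K t) ∈ N) : e ω ∈ N := by
  have hspan : Submodule.span O (KaehlerDifferential.D ℂ K '' O) ≤
      N.comap (e.restrictScalars O) := Submodule.span_le.2 <| by
    rintro _ ⟨t, ht, rfl⟩
    exact hN t ht
  exact hspan (hω O hO)

theorem map_mem_regularDifferentials [Algebra K L] [IsScalarTower ℂ K L] {ω : Ω[K⁄ℂ]}
    (hω : ω ∈ regularDifferentials K) :
    KaehlerDifferential.map ℂ ℂ K L ω ∈ regularDifferentials L := by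
  intro O hO
  let N : Submodule (O.comap (algebraMap K L)) (Ω[L⁄ℂ]) :=
    { Submodule.span O (KaehlerDifferential.D ℂ L '' O) with
      smul_mem' := fun a x hx => by
        have h := Submodule.smul_mem _ (⟨algebraMap K L a, a.2⟩ : O) hx
        rwa [show (⟨algebraMap K L a, a.2⟩ : O) • x = a • x from algebraMap_smul L (a : K) x] at h }
  refine map_mem_of_mem_regularDifferentials hω (KaehlerDifferential.map ℂ ℂ K L)
    (O := O.comap (algebraMap K L)) (fun c => ?_) N fun t ht => ?_
  · rw [ValuationSubring.mem_comap, ← IsScalarTower.algebraMap_apply]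
    exact hO c
  · rw [KaehlerDifferential.map_D]
    exact Submodule.subset_span ⟨_, ht, rfl⟩

theorem regularDifferentials_eq_bot_of_algHom [Algebra.EssFiniteType ℂ L] (f : K →ₐ[ℂ] L)
    (hL : regularDifferentials L = ⊥) : regularDifferentials K = ⊥ := by
  let _ : Algebra K L := f.toAlgebra
  have : IsScalarTower ℂ K L := IsScalarTower.of_algHom f
  have : CharZero K := charZero_of_injective_algebraMap (algebraMap ℂ K).injective
  refine (Submodule.eq_bot_iff _).2 fun ω hω => ?_
  have hω' := map_mem_regularDifferentials (L := L) hω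
  rw [hL, Submodule.mem_bot] at hω'
  exact map_kaehlerDifferential_injective_of_perfectField ℂ K L (hω'.trans (map_zero _).symm)

end RegularDifferentials

section RationalFunctionField

instance essFiniteType_ratFunc (k : Type*) [Field k] : Algebra.EssFiniteType k (RatFunc k) :=
  have : Algebra.EssFiniteType k[X] (RatFunc k) := .of_isLocalization _ k[X]⁰
  .comp k k[X] (RatFunc k)

/-- The isomorphism `Ω[k(X)⁄k] ≃ k(X)` that sends `dX` to `1`, i.e. the coordinate of a
differential with respect to `dX`. -/
noncomputable def ratFuncKaehlerEquiv (k : Type*) [Field k] :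
    Ω[RatFunc k⁄k] ≃ₗ[RatFunc k] RatFunc k :=
  have : Algebra.FormallyEtale k[X] (RatFunc k) := .of_isLocalization k[X]⁰
  (KaehlerDifferential.tensorKaehlerEquivOfFormallyEtale k k[X] (RatFunc k)).symm ≪≫ₗ
    TensorProduct.AlgebraTensorModule.congr (.refl _ _) (KaehlerDifferential.polynomialEquiv k) ≪≫ₗ
    TensorProduct.AlgebraTensorModule.rid k[X] (RatFunc k) (RatFunc k)

variable {k : Type*} [Field k]

theorem ratFuncKaehlerEquiv_D_algebraMap (p : k[X]) :
    ratFuncKaehlerEquiv k (KaehlerDifferential.D k (RatFunc k) (algebraMap _ _ p)) =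
      algebraMap _ _ p.derivative := by
  have : Algebra.FormallyEtale k[X] (RatFunc k) := .of_isLocalization k[X]⁰
  simp only [ratFuncKaehlerEquiv, LinearEquiv.trans_apply]
  rw [KaehlerDifferential.tensorKaehlerEquivOfFormallyEtale_symm_D_algebraMap]
  simp [Algebra.smul_def]

theorem ratFuncKaehlerEquiv_D_div (p q : k[X]) :
    ratFuncKaehlerEquiv k (KaehlerDifferential.D k (RatFunc k)
      (algebraMap _ (RatFunc k) p / algebraMap _ (RatFunc k) q)) =
      algebraMap _ (RatFunc k) (q * p.derivative - p * q.derivative) /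
        algebraMap _ (RatFunc k) q ^ 2 := by
  rw [Derivation.leibniz_div, map_smul, map_sub, map_smul, map_smul,
    ratFuncKaehlerEquiv_D_algebraMap, ratFuncKaehlerEquiv_D_algebraMap]
  simp only [map_sub, map_mul, smul_eq_mul]
  ring

open IsDedekindDomain

theorem valuation_ratFuncKaehlerEquiv_D_le_one (v : HeightOneSpectrum k[X]) {t : RatFunc k}
    (ht : v.valuation (RatFunc k) t ≤ 1) :
    v.valuation (RatFunc k)
      (ratFuncKaehlerEquiv k (KaehlerDifferential.D k (RatFunc k) t)) ≤ 1 := by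
  have hcop : t.denom ∈ v.asIdeal → t.num ∉ v.asIdeal := by
    intro hd hn
    obtain ⟨a, b, hab⟩ := t.isCoprime_num_denom
    exact v.isPrime.one_notMem <|
      hab ▸ add_mem (Ideal.mul_mem_left _ _ hn) (Ideal.mul_mem_left _ _ hd)
  rw [← t.num_div_denom] at ht ⊢
  have hd := (v.valuation_div_le_one_iff _ _ t.denom_ne_zero hcop).1 ht
  rw [ratFuncKaehlerEquiv_D_div, map_div₀, map_pow,
    HeightOneSpectrum.valuation_eq_one_iff_notMem v |>.2 hd, one_pow, div_one]
  exact v.valuation_le_one _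

open Classical in
theorem inftyValuation_derivative_lt {p : k[X]} (hp : p ≠ 0) :
    RatFunc.inftyValuation k (algebraMap _ _ p.derivative) <
      RatFunc.inftyValuation k (algebraMap _ _ p) := by
  rcases eq_or_ne p.derivative 0 with h | h
  · simpa [h, zero_lt_iff] using hp
  · rw [RatFunc.inftyValuation_apply, RatFunc.inftyValuation_apply,
      RatFunc.inftyValuation.polynomial k hp, RatFunc.inftyValuation.polynomial k h,
      WithZero.exp_lt_exp, Nat.cast_lt]
    exact Polynomial.natDegree_derivative_lt fun h0 =>
      h (Polynomial.derivative_of_natDegree_zero h0)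

open Classical in
theorem inftyValuation_ratFuncKaehlerEquiv_D_lt {t : RatFunc k} (ht : t ≠ 0) :
    RatFunc.inftyValuation k (ratFuncKaehlerEquiv k (KaehlerDifferential.D k (RatFunc k) t)) <
      RatFunc.inftyValuation k t := by
  have hn := inftyValuation_derivative_lt (RatFunc.num_ne_zero ht)
  have hd := inftyValuation_derivative_lt t.denom_ne_zero
  have hn0 := zero_le.trans_lt hn
  have hd0 := zero_le.trans_lt hd
  have hnum : RatFunc.inftyValuation k
      (algebraMap _ _ (t.denom * t.num.derivative - t.num * t.denom.derivative)) <
      RatFunc.inftyValuation k (algebraMap _ _ t.num) *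
        RatFunc.inftyValuation k (algebraMap _ _ t.denom) := by
    simp only [map_sub, map_mul]
    refine Valuation.map_sub_lt _ ?_ ?_ <;> rw [map_mul]
    · rw [mul_comm]
      exact mul_lt_mul_of_pos_right hn hd0
    · exact mul_lt_mul_of_pos_left hd hn0
  conv_lhs => rw [← t.num_div_denom]
  conv_rhs => rw [← t.num_div_denom]
  rw [ratFuncKaehlerEquiv_D_div, map_div₀, map_div₀, map_pow, div_lt_iff₀ (pow_pos hd0 2), sq,
    ← mul_assoc, div_mul_cancel₀ _ hd0.ne']
  exact hnum

open Classical in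
theorem inftyValuation_ratFuncKaehlerEquiv_D_lt_one {t : RatFunc k}
    (ht : RatFunc.inftyValuation k t ≤ 1) :
    RatFunc.inftyValuation k
      (ratFuncKaehlerEquiv k (KaehlerDifferential.D k (RatFunc k) t)) < 1 := by
  rcases eq_or_ne t 0 with rfl | h0
  · simp only [map_zero, zero_lt_one]
  · exact (inftyValuation_ratFuncKaehlerEquiv_D_lt h0).trans_le ht

theorem regularDifferentials_ratFunc : regularDifferentials (RatFunc ℂ) = ⊥ := by
  classical
  refine (Submodule.eq_bot_iff _).2 fun ω hω => ?_
  obtain ⟨p, hp⟩ : ratFuncKaehlerEquiv ℂ ω ∈ (algebraMap ℂ[X] (RatFunc ℂ)).range :=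
    HeightOneSpectrum.mem_integers_of_valuation_le_one _ _ fun v =>
      map_mem_of_mem_regularDifferentials hω (ratFuncKaehlerEquiv ℂ).toLinearMap
        (O := (v.valuation (RatFunc ℂ)).valuationSubring) (fun c => v.valuation_le_one (.C c))
        (Valuation.leSubmodule _ 1) fun t => valuation_ratFuncKaehlerEquiv_D_le_one v
  have hinfty : RatFunc.inftyValuation ℂ (ratFuncKaehlerEquiv ℂ ω) < 1 :=
    map_mem_of_mem_regularDifferentials hω (ratFuncKaehlerEquiv ℂ).toLinearMap
      (O := (RatFunc.inftyValuation ℂ).valuationSubring)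
      (fun c => Valuation.IsTrivialOn.valuation_algebraMap_le_one (RatFunc.inftyValuation ℂ) c)
      (Valuation.ltSubmodule _ 1) fun t => inftyValuation_ratFuncKaehlerEquiv_D_lt_one
  rw [← (ratFuncKaehlerEquiv ℂ).map_eq_zero_iff, ← hp]
  by_contra h0
  rw [map_eq_zero_iff _ (RatFunc.algebraMap_injective ℂ)] at h0
  rw [← hp, RatFunc.inftyValuation_apply, RatFunc.inftyValuation.polynomial ℂ h0,
    ← WithZero.exp_zero, WithZero.exp_lt_exp] at hinfty
  omega

end RationalFunctionField

section SpreadingOut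

variable {R K : Type*} [CommRing R] [IsDomain R] [Field K] [Algebra R K] [IsFractionRing R K]

open Matrix in
theorem exists_mul_eq_smul_one_of_linearIndependent_row {ι κ : Type*} [Finite ι] [DecidableEq ι]
    [Fintype κ] {A : Matrix ι κ R} (hA : LinearIndependent K (A.map (algebraMap R K)).row) :
    ∃ c : R, c ≠ 0 ∧ ∃ B : Matrix κ ι R, A * B = c • 1 := by
  cases nonempty_fintype ι
  have hsurj : Function.Surjective (A.map (algebraMap R K)).mulVec :=
    LinearMap.range_eq_top.1 <| Submodule.eq_top_of_finrank_eq <|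
      (LinearIndependent.rank_matrix hA).trans (Module.finrank_pi K).symm
  obtain ⟨B, hB⟩ := mulVec_surjective_iff_exists_right_inverse.1 hsurj
  obtain ⟨c, hc⟩ := IsLocalization.exist_integer_multiples_of_finite R⁰
    fun p : κ × ι => B p.1 p.2
  choose B' hB' using hc
  refine ⟨c, nonZeroDivisors.coe_ne_zero c, Matrix.of fun j i => B' (j, i), ?_⟩
  have hB'' : (Matrix.of fun j i => B' (j, i)).map (algebraMap R K) = (c : R) • B := by
    ext j i
    exact hB' (j, i)
  apply Matrix.map_injective (IsFractionRing.injective R K)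
  beta_reduce
  rw [Matrix.map_mul, hB'', Matrix.mul_smul, hB]
  ext i j
  rw [map_apply, Matrix.smul_apply, Matrix.smul_apply, one_apply, one_apply]
  split_ifs <;> simp [Algebra.smul_def]

variable {k : Type*} [Field k]

theorem exists_forall_linearIndependent_row_map {ι κ : Type*} [Finite ι] [Finite κ]
    {A : Matrix ι κ R} (hA : LinearIndependent K (A.map (algebraMap R K)).row) :
    ∃ c : R, c ≠ 0 ∧ ∀ φ : R →+* k, φ c ≠ 0 → LinearIndependent k (A.map φ).row := by
  classical
  cases nonempty_fintype ι
  cases nonempty_fintype κ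
  obtain ⟨c, hc, B, hAB⟩ := exists_mul_eq_smul_one_of_linearIndependent_row hA
  refine ⟨c, hc, fun φ hφ => ?_⟩
  have hAB' : A.map φ * B.map φ = φ c • 1 := by
    rw [← Matrix.map_mul, hAB]
    ext i j
    simp [Matrix.one_apply, apply_ite φ]
  rw [← Matrix.vecMul_injective_iff]
  refine .of_comp (f := (B.map φ).vecMul) ?_
  have hcomp : (B.map φ).vecMul ∘ (A.map φ).vecMul = fun x => φ c • x := by
    ext1 x
    rw [Function.comp_apply, Matrix.vecMul_vecMul, hAB', Matrix.vecMul_smul, Matrix.vecMul_one]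
  rw [hcomp]
  exact smul_right_injective _ hφ

theorem linearIndependent_coeff_iff {S ι : Type*} [CommRing S] {p : ι → S[X]} {N : ℕ}
    (hN : ∀ i, (p i).natDegree < N) :
    LinearIndependent S (fun i (j : Fin N) => (p i).coeff j) ↔ LinearIndependent S p := by
  have hspan : Submodule.span S (Set.range p) ≤ Polynomial.degreeLT S N := by
    rw [Submodule.span_le]
    rintro _ ⟨i, rfl⟩
    exact Polynomial.mem_degreeLT.2 <| Polynomial.degree_le_natDegree.trans_lt <|
      Nat.cast_lt.2 (hN i)
  have hcoeff {q : S[X]} (hq : q ∈ Submodule.span S (Set.range p)) {n : ℕ} (hn : N ≤ n) :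
      q.coeff n = 0 :=
    Polynomial.coeff_eq_zero_of_degree_lt <|
      (Polynomial.mem_degreeLT.1 (hspan hq)).trans_le (Nat.cast_le.2 hn)
  refine LinearMap.linearIndependent_iff_of_injOn
    (LinearMap.pi fun j : Fin N => Polynomial.lcoeff S j) fun f hf g hg hfg =>
      Polynomial.ext fun n => ?_
  rcases lt_or_ge n N with hn | hn
  · exact congrFun hfg ⟨n, hn⟩
  · rw [hcoeff hf hn, hcoeff hg hn]

theorem linearIndependent_row_map_coeff_iff {S ι : Type*} [Semiring S] (φ : S →+* k) {p : ι → S[X]}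
    {N : ℕ} (hN : ∀ i, (p i).natDegree < N) :
    LinearIndependent k ((Matrix.of fun i (j : Fin N) => (p i).coeff j).map φ).row ↔
      LinearIndependent k fun i => (p i).map φ := by
  rw [← linearIndependent_coeff_iff fun i => Polynomial.natDegree_map_le.trans_lt (hN i)]
  simp only [Polynomial.coeff_map]
  rfl

theorem exists_forall_linearIndependent_polynomial_map {ι : Type*} [Finite ι] {p : ι → R[X]}
    (hp : LinearIndependent K fun i => (p i).map (algebraMap R K)) :
    ∃ c : R, c ≠ 0 ∧ ∀ φ : R →+* k, φ c ≠ 0 → LinearIndependent k fun i => (p i).map φ := by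
  obtain ⟨N, hN⟩ : ∃ N, ∀ i, (p i).natDegree < N := by
    obtain ⟨N, hN⟩ := Set.finite_range (fun i => (p i).natDegree) |>.bddAbove
    exact ⟨N + 1, fun i => Nat.lt_succ_of_le (hN ⟨i, rfl⟩)⟩
  obtain ⟨c, hc, hcφ⟩ := exists_forall_linearIndependent_row_map (k := k)
    ((linearIndependent_row_map_coeff_iff _ hN).2 hp)
  exact ⟨c, hc, fun φ hφ => (linearIndependent_row_map_coeff_iff φ hN).1 (hcφ φ hφ)⟩

end SpreadingOut

section MonomialIndependence

open MvPolynomial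

variable {σ k L : Type*} [CommRing L] {v : σ → L}

section CommRing

variable [CommRing k] [Algebra k L]

theorem aeval_ofCoeff_eq_linearCombination (l : (σ →₀ ℕ) →₀ k) :
    aeval v (AddMonoidAlgebra.ofCoeff l : MvPolynomial σ k) =
      Finsupp.linearCombination k (fun m => aeval v (monomial m (1 : k))) l := by
  simp only [Finsupp.linearCombination_apply, aeval_monomial, map_one, one_mul, Algebra.smul_def]
  rfl

theorem linearIndependent_aeval_monomial_iff {s : Set (σ →₀ ℕ)} :
    LinearIndependent k (fun m : s => aeval v (monomial (m : σ →₀ ℕ) (1 : k))) ↔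
      ∀ G : MvPolynomial σ k, ↑G.support ⊆ s → aeval v G = 0 → G = 0 := by
  have hon : LinearIndependent k (fun m : s => aeval v (monomial (m : σ →₀ ℕ) (1 : k))) ↔
      LinearIndepOn k (fun m => aeval v (monomial m (1 : k))) s := Iff.rfl
  rw [hon, linearIndepOn_iff]
  refine Iff.trans ?_ AddMonoidAlgebra.forall.symm
  simp only [aeval_ofCoeff_eq_linearCombination]
  exact forall₃_congr fun _ _ _ => AddMonoidAlgebra.ofCoeff_injective.eq_iff.symm

theorem eq_zero_of_dvd_of_totalDegree_le_of_coeff_eq_zero [IsDomain k]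
    {F G : MvPolynomial σ k} {m₀ : σ →₀ ℕ} (hG : F ∣ G) (hdeg : G.totalDegree ≤ F.totalDegree)
    (hF : coeff m₀ F ≠ 0) (hG₀ : coeff m₀ G = 0) : G = 0 := by
  by_contra hne
  obtain ⟨H, rfl⟩ := hG
  have hH : H.totalDegree = 0 := by
    rw [totalDegree_mul_of_isDomain (left_ne_zero_of_mul hne) (right_ne_zero_of_mul hne)] at hdeg
    omega
  rw [totalDegree_eq_zero_iff_eq_C] at hH
  rw [hH, mul_comm, coeff_C_mul] at hG₀
  rcases mul_eq_zero.1 hG₀ with h | h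
  · exact hne (by rw [hH, h, C_0, mul_zero])
  · exact hF h

theorem linearIndependent_aeval_monomial_of_ker_eq_span [IsDomain k] {F : MvPolynomial σ k}
    {m₀ : σ →₀ ℕ}
    (hker : RingHom.ker (aeval v : MvPolynomial σ k →ₐ[k] L) = Ideal.span {F})
    (hm₀ : coeff m₀ F ≠ 0) :
    LinearIndependent k fun m : {m : σ →₀ ℕ | m.degree ≤ F.totalDegree ∧ m ≠ m₀} =>
      aeval v (monomial (m : σ →₀ ℕ) (1 : k)) := by
  refine linearIndependent_aeval_monomial_iff.2 fun G hG hv => ?_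
  refine eq_zero_of_dvd_of_totalDegree_le_of_coeff_eq_zero ?_ ?_ hm₀ ?_
  · rwa [← Ideal.mem_span_singleton, ← hker]
  · exact Finset.sup_le fun m hm => (hG hm).1
  · exact notMem_support_iff.1 fun hm => (hG hm).2 rfl

end CommRing

variable [Field k] [Algebra k L] {f : MvPolynomial σ k} {d : ℕ} {m₀ : σ →₀ ℕ}

theorem dvd_of_linearIndependent_aeval_monomial (hli : LinearIndependent k
      fun m : {m : σ →₀ ℕ | m.degree ≤ d ∧ m ≠ m₀} => aeval v (monomial (m : σ →₀ ℕ) (1 : k)))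
    (hfd : f.totalDegree ≤ d) (hm₀ : coeff m₀ f ≠ 0) (hf : aeval v f = 0)
    {g : MvPolynomial σ k} (hgd : g.totalDegree ≤ d) (hg : aeval v g = 0) : f ∣ g := by
  -- The combination of `f` and `g` in which the excluded monomial `m₀` cancels.
  have hzero : coeff m₀ f • g - coeff m₀ g • f = 0 := by
    refine linearIndependent_aeval_monomial_iff.1 hli _ (fun m hm => ⟨?_, ?_⟩) ?_
    · refine (le_totalDegree hm).trans <| (totalDegree_sub _ _).trans <| max_le ?_ ?_
      · exact (totalDegree_smul_le _ _).trans hgd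
      · exact (totalDegree_smul_le _ _).trans hfd
    · rintro rfl
      refine mem_support_iff.1 hm ?_
      rw [coeff_sub, coeff_smul, coeff_smul, smul_eq_mul, smul_eq_mul, mul_comm, sub_self]
    · rw [map_sub, map_smul, map_smul, hf, hg, smul_zero, smul_zero, sub_zero]
  have hdvd : f ∣ coeff m₀ f • g := ⟨C (coeff m₀ g), by
    rw [sub_eq_zero.1 hzero, smul_eq_C_mul, mul_comm]⟩
  rwa [smul_eq_C_mul, IsUnit.dvd_mul_left ((isUnit_iff_ne_zero.2 hm₀).map C)] at hdvd

theorem irreducible_of_linearIndependent_aeval_monomial [IsDomain L] (hli : LinearIndependent k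
      fun m : {m : σ →₀ ℕ | m.degree ≤ d ∧ m ≠ m₀} => aeval v (monomial (m : σ →₀ ℕ) (1 : k)))
    (hfd : f.totalDegree ≤ d) (hm₀ : coeff m₀ f ≠ 0) (hf : aeval v f = 0) : Irreducible f := by
  have hne : f ≠ 0 := by
    rintro rfl
    exact hm₀ (coeff_zero _)
  have hunit {g h : MvPolynomial σ k} (hgh : f = g * h) (hg : aeval v g = 0) : IsUnit h := by
    have hgd : g.totalDegree ≤ d := by
      rw [hgh, totalDegree_mul_of_isDomain (left_ne_zero_of_mul (hgh ▸ hne))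
        (right_ne_zero_of_mul (hgh ▸ hne))] at hfd
      omega
    have hdvd := dvd_of_linearIndependent_aeval_monomial hli hfd hm₀ hf hgd hg
    rw [hgh] at hdvd
    exact isUnit_of_dvd_one <|
      (mul_dvd_mul_iff_left (left_ne_zero_of_mul (hgh ▸ hne))).1 (by rwa [mul_one])
  refine ⟨fun hu => (hu.map (aeval v)).ne_zero hf, fun g h hgh => ?_⟩
  have hprod : aeval v g * aeval v h = 0 := by rw [← map_mul, ← hgh, hf]
  rcases mul_eq_zero.1 hprod with hg | hh
  · exact .inr (hunit hgh hg)
  · exact .inl (hunit (hgh.trans (mul_comm _ _)) hh)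

end MonomialIndependence

section Parametrization

open MvPolynomial

variable {σ R : Type*} [CommRing R] {k : Type*} [Field k]

/-- The parametrization `Pᵢ(X) / Q(X)` over `k` obtained from numerators `P` and a common
denominator `Q` over `R` by applying `φ : R →+* k` to the coefficients; it is the point over
the function field `k(X)` at which `MvPolynomial`s are evaluated. It is `0` if `φ` kills `Q`. -/
noncomputable def parametrization (φ : R →+* k) (P : σ → R[X]) (Q : R[X]) : σ → RatFunc k :=
  fun i => algebraMap k[X] (RatFunc k) ((P i).map φ) / algebraMap k[X] (RatFunc k) (Q.map φ)

/-- The polynomial `Q ^ d * G(P / Q)`, with denominators cancelled monomial by monomial. The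
truncated exponents `d - m.degree` are the intended ones if `G.totalDegree ≤ d`. -/
noncomputable def clearedEval (P : σ → R[X]) (Q : R[X]) (d : ℕ) (G : MvPolynomial σ R) : R[X] :=
  ∑ m ∈ G.support, .C (G.coeff m) * (Q ^ (d - m.degree) * m.prod fun i e => P i ^ e)

variable {P : σ → R[X]} {Q : R[X]} {φ : R →+* k} {d : ℕ}

theorem pow_mul_prod_parametrization (hQ : Q.map φ ≠ 0) {m : σ →₀ ℕ} (hm : m.degree ≤ d) :
    algebraMap k[X] (RatFunc k) (Q.map φ) ^ d * m.prod (fun i e => parametrization φ P Q i ^ e) =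
      algebraMap k[X] (RatFunc k)
        ((Q ^ (d - m.degree) * m.prod fun i e => P i ^ e).map φ) := by
  have hQ' : algebraMap k[X] (RatFunc k) (Q.map φ) ≠ 0 := RatFunc.algebraMap_ne_zero hQ
  have hprod : algebraMap k[X] (RatFunc k) (Q.map φ) ^ m.degree *
      m.prod (fun i e => parametrization φ P Q i ^ e) =
        m.prod fun i e => algebraMap k[X] (RatFunc k) ((P i).map φ) ^ e := by
    rw [Finsupp.degree_apply, ← Finset.prod_pow_eq_pow_sum, Finsupp.prod, Finsupp.prod,
      ← Finset.prod_mul_distrib]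
    refine Finset.prod_congr rfl fun i _ => ?_
    rw [← mul_pow, parametrization, mul_div_cancel₀ _ hQ']
  rw [← Nat.sub_add_cancel hm, pow_add, mul_assoc, hprod, Nat.sub_add_cancel hm]
  simp only [Polynomial.map_mul, Polynomial.map_pow, map_mul, map_pow, Finsupp.prod,
    Polynomial.map_prod, map_prod]

theorem algebraMap_map_clearedEval (hQ : Q.map φ ≠ 0) {G : MvPolynomial σ R}
    (hG : G.totalDegree ≤ d) :
    algebraMap k[X] (RatFunc k) ((clearedEval P Q d G).map φ) =
      algebraMap k[X] (RatFunc k) (Q.map φ) ^ d * aeval (parametrization φ P Q) (map φ G) := by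
  rw [clearedEval, Polynomial.map_sum, map_sum, aeval_def, eval₂_map, eval₂_eq, Finset.mul_sum]
  refine Finset.sum_congr rfl fun m hm => ?_
  rw [Polynomial.map_mul, map_mul, Polynomial.map_C, mul_left_comm,
    ← pow_mul_prod_parametrization hQ ((le_totalDegree hm).trans hG)]
  rfl

theorem linearIndependent_clearedEval_iff (hQ : Q.map φ ≠ 0) {ι : Type*}
    {G : ι → MvPolynomial σ R} (hG : ∀ i, (G i).totalDegree ≤ d) :
    (LinearIndependent k fun i => (clearedEval P Q d (G i)).map φ) ↔
      LinearIndependent k fun i => aeval (parametrization φ P Q) (map φ (G i)) := by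
  have hQ' : algebraMap k[X] (RatFunc k) (Q.map φ) ^ d ≠ 0 :=
    pow_ne_zero _ (RatFunc.algebraMap_ne_zero hQ)
  have hcomp : (IsScalarTower.toAlgHom k k[X] (RatFunc k)).toLinearMap ∘
      (fun i => (clearedEval P Q d (G i)).map φ) =
        LinearMap.mulLeft k (algebraMap k[X] (RatFunc k) (Q.map φ) ^ d) ∘
          fun i => aeval (parametrization φ P Q) (map φ (G i)) :=
    funext fun i => algebraMap_map_clearedEval hQ (hG i)
  have hker : LinearMap.ker (IsScalarTower.toAlgHom k k[X] (RatFunc k)).toLinearMap = ⊥ :=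
    LinearMap.ker_eq_bot.2 (RatFunc.algebraMap_injective k)
  rw [← LinearMap.linearIndependent_iff _ hker, hcomp,
    LinearMap.linearIndependent_iff _ (LinearMap.ker_eq_bot.2 (mul_right_injective₀ hQ'))]

theorem clearedEval_eq_zero_iff (hφ : Function.Injective φ) (hQ : Q ≠ 0) {G : MvPolynomial σ R}
    (hG : G.totalDegree ≤ d) :
    clearedEval P Q d G = 0 ↔ aeval (parametrization φ P Q) (map φ G) = 0 := by
  have hQφ : Q.map φ ≠ 0 := (Polynomial.map_ne_zero_iff hφ).2 hQ
  rw [← Polynomial.map_eq_zero_iff hφ, ← map_eq_zero_iff _ (RatFunc.algebraMap_injective k),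
    algebraMap_map_clearedEval hQφ hG,
    mul_eq_zero_iff_left (pow_ne_zero _ (RatFunc.algebraMap_ne_zero hQφ))]

variable {K : Type*} [Field K] [Algebra R K] [IsFractionRing R K]

theorem aeval_parametrization_eq_zero_of_generic (hQ : Q ≠ 0) {G : MvPolynomial σ R}
    (hG : aeval (parametrization (algebraMap R K) P Q) (map (algebraMap R K) G) = 0)
    (hφ : Q.map φ ≠ 0) : aeval (parametrization φ P Q) (map φ G) = 0 := by
  have hzero : clearedEval P Q G.totalDegree G = 0 :=
    (clearedEval_eq_zero_iff (IsFractionRing.injective R K) hQ le_rfl).2 hG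
  have hmap := algebraMap_map_clearedEval (P := P) hφ (le_refl G.totalDegree)
  rw [hzero, Polynomial.map_zero, map_zero, eq_comm] at hmap
  exact (mul_eq_zero_iff_left (pow_ne_zero _ (RatFunc.algebraMap_ne_zero hφ))).1 hmap

theorem exists_forall_linearIndependent_aeval_parametrization [IsDomain R] (hQ : Q ≠ 0)
    {ι : Type*} [Finite ι] {G : ι → MvPolynomial σ R}
    (hG : LinearIndependent K fun i =>
      aeval (parametrization (algebraMap R K) P Q) (map (algebraMap R K) (G i))) :
    ∃ c : R, c ≠ 0 ∧ ∀ φ : R →+* k, φ c ≠ 0 → Q.map φ ≠ 0 →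
      LinearIndependent k fun i => aeval (parametrization φ P Q) (map φ (G i)) := by
  obtain ⟨d, hd⟩ := (Set.finite_range fun i => (G i).totalDegree).bddAbove
  have hd' (i) : (G i).totalDegree ≤ d := hd ⟨i, rfl⟩
  obtain ⟨c, hc, hcφ⟩ := exists_forall_linearIndependent_polynomial_map (k := k) <|
    (linearIndependent_clearedEval_iff
      ((Polynomial.map_ne_zero_iff (IsFractionRing.injective R K)).2 hQ) hd').2 hG
  exact ⟨c, hc, fun φ hφ hQφ => (linearIndependent_clearedEval_iff hQφ hd').1 (hcφ φ hφ)⟩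

theorem exists_forall_linearIndependent_aeval_monomial [IsDomain R] (hQ : Q ≠ 0)
    {s : Set (σ →₀ ℕ)} [Finite s] (hs : LinearIndependent K fun m : s =>
      aeval (parametrization (algebraMap R K) P Q) (monomial (m : σ →₀ ℕ) (1 : K))) :
    ∃ c : R, c ≠ 0 ∧ ∀ φ : R →+* k, φ c ≠ 0 → Q.map φ ≠ 0 →
      LinearIndependent k fun m : s =>
        aeval (parametrization φ P Q) (monomial (m : σ →₀ ℕ) (1 : k)) := by
  have hs' : LinearIndependent K fun m : s => aeval (parametrization (algebraMap R K) P Q)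
      (map (algebraMap R K) (monomial (m : σ →₀ ℕ) (1 : R))) := by
    simpa only [map_monomial, map_one] using hs
  obtain ⟨c, hc, hcφ⟩ := exists_forall_linearIndependent_aeval_parametrization (k := k) hQ hs'
  refine ⟨c, hc, fun φ hφ hQφ => ?_⟩
  simpa only [map_monomial, map_one] using hcφ φ hφ hQφ

theorem exists_forall_irreducible_map [IsDomain R] [Finite σ] (hQ : Q ≠ 0) {F : MvPolynomial σ R}
    (hF : F ≠ 0)
    (hker : RingHom.ker (aeval (parametrization (algebraMap R K) P Q) :
      MvPolynomial σ K →ₐ[K] RatFunc K) = Ideal.span {map (algebraMap R K) F}) :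
    ∃ c : R, c ≠ 0 ∧ ∀ φ : R →+* k, φ c ≠ 0 → Q.map φ ≠ 0 → Irreducible (map φ F) := by
  have hinj : Function.Injective (algebraMap R K) := IsFractionRing.injective R K
  obtain ⟨m₀, hm₀⟩ := ne_zero_iff.1 hF
  have hm₀' : coeff m₀ (map (algebraMap R K) F) ≠ 0 := by
    rwa [coeff_map, ne_eq, map_eq_zero_iff _ hinj]
  have hfin : Finite {m : σ →₀ ℕ | m.degree ≤ (map (algebraMap R K) F).totalDegree ∧ m ≠ m₀} :=
    (Finsupp.finite_of_degree_le _).subset fun _ hm => hm.1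
  obtain ⟨c, hc, hcφ⟩ := exists_forall_linearIndependent_aeval_monomial (k := k) hQ
    (linearIndependent_aeval_monomial_of_ker_eq_span hker hm₀')
  refine ⟨c * coeff m₀ F, mul_ne_zero hc hm₀, fun φ hφ hQφ => ?_⟩
  rw [map_mul] at hφ
  have hdeg : (map φ F).totalDegree ≤ (map (algebraMap R K) F).totalDegree := by
    refine Finset.sup_mono ?_
    rw [support_map_of_injective _ hinj]
    exact support_map_subset _ _
  have hzero : aeval (parametrization (algebraMap R K) P Q) (map (algebraMap R K) F) = 0 := by
    rw [← RingHom.mem_ker, hker]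
    exact Ideal.mem_span_singleton_self _
  exact irreducible_of_linearIndependent_aeval_monomial
    (hcφ φ (left_ne_zero_of_mul hφ) hQφ) hdeg
    (by rw [coeff_map]; exact right_ne_zero_of_mul hφ)
    (aeval_parametrization_eq_zero_of_generic hQ hzero hQφ)

theorem linearIndependent_aeval_X_one_iff {v : σ → RatFunc k} {i : σ} :
    (LinearIndependent k fun j : Fin 2 => aeval v (map φ (![X i, 1] j))) ↔
      v i ∉ Set.range (algebraMap k (RatFunc k)) := by
  simp [linearIndependent_fin2, Algebra.smul_def]

theorem exists_forall_parametrization_notMem_range [IsDomain R] (hQ : Q ≠ 0) {i : σ}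
    (hi : parametrization (algebraMap R K) P Q i ∉ Set.range (algebraMap K (RatFunc K))) :
    ∃ c : R, c ≠ 0 ∧ ∀ φ : R →+* k, φ c ≠ 0 → Q.map φ ≠ 0 →
      parametrization φ P Q i ∉ Set.range (algebraMap k (RatFunc k)) := by
  obtain ⟨c, hc, hcφ⟩ := exists_forall_linearIndependent_aeval_parametrization (k := k) hQ
    (linearIndependent_aeval_X_one_iff.2 hi)
  exact ⟨c, hc, fun φ hφ hQφ => linearIndependent_aeval_X_one_iff.1 (hcφ φ hφ hQφ)⟩

end Parametrization

section CommonDenominators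

variable {R K : Type*} [CommRing R] [IsDomain R] [Field K] [Algebra R K] [IsFractionRing R K]

theorem exists_mvPolynomial_map_eq_C_mul {σ : Type*} (F : MvPolynomial σ K) :
    ∃ a : R, a ≠ 0 ∧ ∃ F' : MvPolynomial σ R,
      F'.map (algebraMap R K) = .C (algebraMap R K a) * F := by
  let _ : Algebra (MvPolynomial σ R) (MvPolynomial σ K) := MvPolynomial.algebraMvPolynomial
  obtain ⟨⟨_, a, ha, rfl⟩, F', hF'⟩ :=
    IsLocalization.exists_integer_multiple (R⁰.map (MvPolynomial.C (σ := σ))) F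
  refine ⟨a, nonZeroDivisors.ne_zero ha, F', ?_⟩
  rwa [Algebra.smul_def, MvPolynomial.algebraMap_def, MvPolynomial.map_C] at hF'

theorem exists_polynomial_map_eq_C_mul_of_finite {ι : Type*} [Finite ι] (p : ι → K[X]) :
    ∃ a : R, a ≠ 0 ∧ ∃ p' : ι → R[X],
      ∀ i, (p' i).map (algebraMap R K) = .C (algebraMap R K a) * p i := by
  let _ : Algebra R[X] K[X] := Polynomial.algebra R K
  have : IsLocalization (R⁰.map Polynomial.C) K[X] := Polynomial.isLocalization R⁰ K
  obtain ⟨⟨_, a, ha, rfl⟩, h⟩ :=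
    IsLocalization.exist_integer_multiples_of_finite (R⁰.map (Polynomial.C (R := R))) p
  choose p' hp' using h
  refine ⟨a, nonZeroDivisors.ne_zero ha, p', fun i => ?_⟩
  simpa [Algebra.smul_def] using hp' i

theorem exists_eq_parametrization {σ : Type*} [Finite σ] (v : σ → RatFunc K) :
    ∃ (P : σ → R[X]) (Q : R[X]), Q ≠ 0 ∧ v = parametrization (algebraMap R K) P Q := by
  obtain ⟨⟨q, hq⟩, h⟩ := IsLocalization.exist_integer_multiples_of_finite K[X]⁰ v
  choose p hp using h
  obtain ⟨a, ha, p', hp'⟩ := exists_polynomial_map_eq_C_mul_of_finite (R := R)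
    fun i : Option σ => i.elim q p
  have ha' : algebraMap R K a ≠ 0 := (map_ne_zero_iff _ (IsFractionRing.injective R K)).2 ha
  refine ⟨fun i => p' (some i), p' none, fun h => ?_, funext fun i => ?_⟩
  · have h' := hp' none
    rw [h, Polynomial.map_zero, eq_comm, mul_eq_zero, Polynomial.C_eq_zero] at h'
    exact h'.elim ha' (nonZeroDivisors.ne_zero hq)
  · have hq' : algebraMap K[X] (RatFunc K) q ≠ 0 :=
      RatFunc.algebraMap_ne_zero (nonZeroDivisors.ne_zero hq)
    have hC : algebraMap K[X] (RatFunc K) (.C (algebraMap R K a)) ≠ 0 :=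
      RatFunc.algebraMap_ne_zero (Polynomial.C_ne_zero.2 ha')
    have hpi : algebraMap K[X] (RatFunc K) (p i) = algebraMap K[X] (RatFunc K) q * v i :=
      (hp i).trans (Algebra.smul_def _ _)
    rw [parametrization, hp', hp', map_mul, map_mul, mul_div_mul_left _ _ hC, Option.elim_some,
      Option.elim_none, hpi, mul_div_cancel_left₀ _ hq']

end CommonDenominators

section RationalCurve

theorem planeCurveGenus_eq_zero_of_parametrization {f : MvPolynomial (Fin 2) ℂ}
    (hf : Irreducible f) {w : Fin 2 → RatFunc ℂ} (hw : MvPolynomial.aeval w f = 0) {i : Fin 2}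
    (hwi : w i ∉ Set.range (algebraMap ℂ (RatFunc ℂ))) : planeCurveGenus f hf = 0 := by
  have : IsDomain (CoordRing f) := isDomain_coordRing hf
  have hker := ker_aeval_eq_span_of_notMem_range hf hw hwi
  have hle : ∀ a ∈ Ideal.span {f}, MvPolynomial.aeval w a = 0 := hker.ge
  have hinj : Function.Injective (Ideal.Quotient.liftₐ (Ideal.span {f}) _ hle) :=
    (Ideal.injective_lift_iff hle).2 hker
  have hreg : regularDifferentials (FractionRing (CoordRing f)) = ⊥ :=
    regularDifferentials_eq_bot_of_algHom (IsFractionRing.liftAlgHom hinj)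
      regularDifferentials_ratFunc
  rw [planeCurveGenus, functionFieldGenus, hreg]
  exact rank_bot ℂ _

end RationalCurve

section Specialization

open Polynomial

theorem coeff_specializeAt (F : MvPolynomial (Fin 2) (RatFunc ℂ)) (z : ℂ) (m : Fin 2 →₀ ℕ) :
    (specializeAt F z).coeff m = (F.coeff m).eval (RingHom.id ℂ) z := by
  classical
  simp only [specializeAt, MvPolynomial.coeff_sum, MvPolynomial.coeff_monomial,
    Finset.sum_ite_eq']
  split_ifs with hm
  · rfl
  · rw [MvPolynomial.notMem_support_iff.1 hm, RatFunc.eval_zero]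

theorem ratFunc_eval_algebraMap_div {k : Type*} [Field k] (p : k[X]) {q : k[X]} {z : k}
    (hq : q.eval z ≠ 0) :
    (algebraMap k[X] (RatFunc k) p / algebraMap k[X] (RatFunc k) q).eval (RingHom.id k) z =
      p.eval z / q.eval z := by
  set x := algebraMap k[X] (RatFunc k) p / algebraMap k[X] (RatFunc k) q with hx
  have hq0 : q ≠ 0 := fun h => hq (by rw [h, eval_zero])
  have hd : x.denom.eval z ≠ 0 := fun h =>
    hq (eval_eq_zero_of_dvd_of_eval_eq_zero (RatFunc.denom_div_dvd p q) h)
  have hnum : x.num * q = p * x.denom := (RatFunc.num_mul_eq_mul_denom_iff hq0).2 hx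
  rw [RatFunc.eval, eval₂_id, eval₂_id, div_eq_div_iff hd hq, ← eval_mul, ← eval_mul, hnum]

variable {F : MvPolynomial (Fin 2) (RatFunc ℂ)} {F' : MvPolynomial (Fin 2) ℂ[X]} {a : ℂ[X]}

theorem specializeAt_eq_C_mul_map
    (hF' : F'.map (algebraMap ℂ[X] (RatFunc ℂ)) = .C (algebraMap ℂ[X] (RatFunc ℂ) a) * F) {z : ℂ}
    (hz : a.eval z ≠ 0) :
    specializeAt F z = .C (a.eval z)⁻¹ * F'.map (evalRingHom z) := by
  have ha : algebraMap ℂ[X] (RatFunc ℂ) a ≠ 0 :=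
    RatFunc.algebraMap_ne_zero fun h => hz (by rw [h, eval_zero])
  ext m
  have hm : F.coeff m =
      algebraMap ℂ[X] (RatFunc ℂ) (F'.coeff m) / algebraMap ℂ[X] (RatFunc ℂ) a := by
    rw [← MvPolynomial.coeff_map, hF', MvPolynomial.coeff_C_mul, mul_div_cancel_left₀ _ ha]
  rw [coeff_specializeAt, hm, ratFunc_eval_algebraMap_div _ hz, MvPolynomial.coeff_C_mul,
    MvPolynomial.coeff_map, coe_evalRingHom, div_eq_inv_mul]

theorem exists_forall_irreducible_specializeAt_and_parametrization (hF : Irreducible F)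
    {v : Fin 2 → RatFuncZLam} (hv : MvPolynomial.aeval v F = 0) {i : Fin 2}
    (hvi : v i ∉ Set.range (algebraMap (RatFunc ℂ) RatFuncZLam)) :
    ∃ b : ℂ[X], b ≠ 0 ∧ ∀ z : ℂ, b.eval z ≠ 0 → Irreducible (specializeAt F z) ∧
      ∃ w : Fin 2 → RatFunc ℂ, MvPolynomial.aeval w (specializeAt F z) = 0 ∧
        w i ∉ Set.range (algebraMap ℂ (RatFunc ℂ)) := by
  obtain ⟨a, ha, F', hF'⟩ := exists_mvPolynomial_map_eq_C_mul (R := ℂ[X]) F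
  obtain ⟨P, Q, hQ, rfl⟩ := exists_eq_parametrization (R := ℂ[X]) v
  have hassoc : Associated F (F'.map (algebraMap ℂ[X] (RatFunc ℂ))) :=
    hF' ▸ (associated_isUnit_mul_right_iff
      ((RatFunc.algebraMap_ne_zero ha).isUnit.map MvPolynomial.C)).2 (.refl F)
  have hker := ker_aeval_eq_span_of_notMem_range hF hv hvi
  rw [Ideal.span_singleton_eq_span_singleton.2 hassoc] at hker
  have hF'0 : F' ≠ 0 := by
    rintro rfl
    exact hassoc.ne_zero_iff.1 hF.ne_zero (map_zero _)
  have hgen : MvPolynomial.aeval (parametrization (algebraMap ℂ[X] (RatFunc ℂ)) P Q)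
      (F'.map (algebraMap ℂ[X] (RatFunc ℂ))) = 0 := by
    rw [hF', map_mul, hv, mul_zero]
  obtain ⟨c, hc, hirr⟩ := exists_forall_irreducible_map (k := ℂ) hQ hF'0 hker
  obtain ⟨c', hc', hnonconst⟩ := exists_forall_parametrization_notMem_range (k := ℂ) hQ hvi
  refine ⟨a * Q.leadingCoeff * c * c',
    mul_ne_zero (mul_ne_zero (mul_ne_zero ha (leadingCoeff_ne_zero.2 hQ)) hc) hc', fun z hz => ?_⟩
  simp only [eval_mul, mul_ne_zero_iff] at hz
  obtain ⟨⟨⟨haz, hQz⟩, hcz⟩, hcz'⟩ := hz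
  have hQφ : Q.map (evalRingHom z) ≠ 0 := fun h => hQz <| by
    rw [leadingCoeff, ← coe_evalRingHom, ← coeff_map, h, coeff_zero]
  have hunit : IsUnit (MvPolynomial.C (σ := Fin 2) (a.eval z)⁻¹) :=
    (inv_ne_zero haz).isUnit.map MvPolynomial.C
  rw [specializeAt_eq_C_mul_map hF' haz]
  refine ⟨(irreducible_isUnit_mul hunit).2 (hirr _ hcz hQφ), parametrization (evalRingHom z) P Q,
    ?_, hnonconst _ hcz' hQφ⟩
  rw [map_mul, aeval_parametrization_eq_zero_of_generic hQ hgen hQφ, mul_zero]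

end Specialization

theorem mainTheorem1_general {F : MvPolynomial (Fin 2) (RatFunc ℂ)} (hF : Irreducible F)
    {v : Fin 2 → RatFuncZLam} (hv : MvPolynomial.aeval v F = 0) {i : Fin 2}
    (hvi : v i ∉ Set.range (algebraMap (RatFunc ℂ) RatFuncZLam)) :
    {z₀ : ℂ | ¬ ∃ h : Irreducible (specializeAt F z₀),
      planeCurveGenus (specializeAt F z₀) h = 0}.Finite := by
  obtain ⟨b, hb, hbz⟩ := exists_forall_irreducible_specializeAt_and_parametrization hF hv hvi
  refine (Polynomial.finite_setOfPred_isRoot hb).subset fun z hz => ?_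
  by_contra hroot
  obtain ⟨hirr, w, hw, hwi⟩ := hbz z hroot
  exact hz ⟨hirr, planeCurveGenus_eq_zero_of_parametrization hirr hw hwi⟩

theorem mainTheorem1 (F : MvPolynomial (Fin 2) (RatFunc ℂ)) (hF : Irreducible F)
    (hsol : ∃ r : RatFuncZLam, IsRationalGeneralSolution F r) :
    {z₀ : ℂ | ¬ ∃ h : Irreducible (specializeAt F z₀),
      planeCurveGenus (specializeAt F z₀) h = 0}.Finite := by
  obtain ⟨r, hr⟩ := hsol
  exact mainTheorem1_general hF hr.solves (i := 0) hr.depends_on_constant
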